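/- Let $d\ge 1$ be an integer, let $S^d=\{x\in\mathbb{R}^{d+1}:|x|=1\}$ with $|\cdot|$ the Euclidean norm, and let $0<\lambda<2$. Let $\sigma_d$ be the normalized uniform (surface) probability measure on $S^d$ and put $$I_\lambda(\sigma_d)=\iint_{S^d\times S^d}|x-y|^\lambda\,d\sigma_d(x)\,d\sigma_d(y).$$ Let $(a_n)_{n=0}^\infty\subset S^d$ be a greedy $\lambda$-energy sequence; that is, writing $U_n(x)=\sum_{k=0}^{n-1}|x-a_k|^\lambda$ for $x\in S^d$ and $n\ge 0$ (so that $U_0\equiv 0$), we have $U_n(a_n)=\max_{x\in S^d}U_n(x)$ for every $n\ge 1$. Then: 1. For every $n\ge 1$, $U_n(a_n)\le U_{n+1}(a_{n+1})\le U_n(a_n)+|a_{n+1}-a_n|^\lambda$. 2. For every $n\ge 1$, the function $U_n$ is not constant on $S^d$. 3. For every $n\ge 1$, $n\,I_\lambda(\sigma_d)<U_n(a_n)\le n\,2^\lambda$; and for every $k\ge 0$, $U_{2k+1}(a_{2k+1})=U_{2k}(a_{2k})+2^\lambda$, where $U_0(a_0)=0$. 4. $\displaystyle\lim_{n\to\infty}\frac{U_n(a_n)}{n}=I_\lambda(\sigma_d)$.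 -/

import Mathlib

open MeasureTheory Filter Topology

noncomputable section

/-- The unit sphere `S^d ⊂ ℝ^{d+1}`, with the Euclidean norm of the ambient space. -/
abbrev UnitSphere (d : ℕ) : Type :=
  Metric.sphere (0 : EuclideanSpace ℝ (Fin (d + 1))) 1

/-- The normalized uniform measure `σ_d` on `S^d`: the surface measure induced by Lebesgue measure
on `ℝ^{d+1}`, divided by its total mass. -/
def uniformMeasure (d : ℕ) : Measure (UnitSphere d) :=
  ((volume : Measure (EuclideanSpace ℝ (Fin (d + 1)))).toSphere Set.univ)⁻¹ •
    (volume : Measure (EuclideanSpace ℝ (Fin (d + 1)))).toSphere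

/-- The continuous `lam`-energy `∬ |x - y|^lam dμ(x) dμ(y)` of a measure `μ` on `S^d`. -/
def contEnergy {d : ℕ} (lam : ℝ) (μ : Measure (UnitSphere d)) : ℝ :=
  ∫ y, ∫ x, ‖(x : EuclideanSpace ℝ (Fin (d + 1))) - y‖ ^ lam ∂μ ∂μ

/-- The discrete potential `U_n(x) = ∑_{k=0}^{n-1} |x - a_k|^lam`. -/
def discretePotential {d : ℕ} (lam : ℝ) (a : ℕ → UnitSphere d) (n : ℕ) (x : UnitSphere d) : ℝ :=
  ∑ k ∈ Finset.range n, ‖(x : EuclideanSpace ℝ (Fin (d + 1))) - a k‖ ^ lam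

/-- `(a_n)` is a greedy `lam`-energy sequence on `S^d`: for every `n ≥ 1`,
`U_n(a_n)` is the maximum of `U_n` over `S^d`. -/
def IsGreedyEnergySequence {d : ℕ} (lam : ℝ) (a : ℕ → UnitSphere d) : Prop :=
  ∀ n : ℕ, 1 ≤ n →
    IsGreatest (Set.range (discretePotential lam a n)) (discretePotential lam a n (a n))

end

/-! By rotation invariance the potential of `uniformMeasure d` is constant, so `U_n` has mean `n I`.
It is continuous, and its maximum exceeds the mean once it is nonconstant. Nonconstancy comes from
second differences at `a 0`: the term centred there contributes order `τ ^ lam`, which for `lam < 2`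
dominates the `-O(τ ^ 2)` from the other terms.

Antipodal pairing gives the odd step: if `U_{2k}` is even, `-a (2k)` maximizes both `U_{2k}` and the
new term.

For the limit, `|x - y| ^ lam = (2 - 2t) ^ (lam / 2)` with `t = ⟪x, y⟫`. Its power series has
nonpositive coefficients beyond the constant one, and each `t ^ k` is a positive definite kernel, so
`N` points have energy at most `N² I` (`sum_norm_sub_rpow_le_contEnergy`). That energy is twice the
sum of `U_n(a_n)` over `n < N`; with monotonicity and `U_n(a_n) ≥ n I`, this forces `U_n(a_n) / n →
I` (`tendsto_div_of_monotone_of_sum_le`). -/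

open MeasureTheory Filter Topology

/-! ### Rotation invariance of the uniform measure -/

section Rotation

open scoped Pointwise RealInnerProductSpace

instance isProbabilityMeasure_uniformMeasure (d : ℕ) :
    IsProbabilityMeasure (uniformMeasure d) := by
  constructor
  rw [uniformMeasure, Measure.smul_apply, smul_eq_mul]
  exact ENNReal.inv_mul_cancel (Measure.measure_univ_ne_zero.2 (Measure.toSphere_ne_zero _)) (measure_ne_top _ _)

instance isOpenPosMeasure_uniformMeasure (d : ℕ) :
    (uniformMeasure d).IsOpenPosMeasure :=
  ⟨fun U hU hne => by
    rw [uniformMeasure, Measure.smul_apply, smul_eq_mul]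
    exact mul_ne_zero (ENNReal.inv_ne_zero.2 (measure_ne_top _ _)) (hU.measure_ne_zero _ hne)⟩

/-- The action of a linear isometry on the unit sphere. -/
noncomputable def sphereIsometry {d : ℕ}
    (f : EuclideanSpace ℝ (Fin (d + 1)) ≃ₗᵢ[ℝ] EuclideanSpace ℝ (Fin (d + 1)))
    (x : UnitSphere d) : UnitSphere d :=
  ⟨f x, by simp⟩

lemma continuous_sphereIsometry {d : ℕ}
    (f : EuclideanSpace ℝ (Fin (d + 1)) ≃ₗᵢ[ℝ] EuclideanSpace ℝ (Fin (d + 1))) :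
    Continuous (sphereIsometry f) :=
  Continuous.subtype_mk (f.continuous.comp continuous_subtype_val) _

/-- Surface measure is read off from the Lebesgue measure of cones, and a linear isometry maps cones
to cones and preserves volume. -/
lemma map_sphereIsometry_uniformMeasure {d : ℕ}
    (f : EuclideanSpace ℝ (Fin (d + 1)) ≃ₗᵢ[ℝ] EuclideanSpace ℝ (Fin (d + 1))) :
    (uniformMeasure d).map (sphereIsometry f) = uniformMeasure d := by
  have hm := (continuous_sphereIsometry f).measurable
  ext s hs
  rw [Measure.map_apply hm hs, uniformMeasure, Measure.smul_apply, Measure.smul_apply,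
    Measure.toSphere_apply' _ hs, Measure.toSphere_apply' _ (hm hs)]
  congr 2
  have hset : Set.Ioo (0 : ℝ) 1 • ((↑) '' (sphereIsometry f ⁻¹' s) :
      Set (EuclideanSpace ℝ (Fin (d + 1)))) =
      f ⁻¹' (Set.Ioo (0 : ℝ) 1 • ((↑) '' s)) := by
    ext x
    simp only [Set.mem_smul, Set.mem_image, Set.mem_preimage]
    constructor
    · rintro ⟨r, hr, _, ⟨y, hy, rfl⟩, rfl⟩
      exact ⟨r, hr, _, ⟨_, hy, rfl⟩, by simp [sphereIsometry]⟩
    · rintro ⟨r, hr, _, ⟨y, hy, rfl⟩, h⟩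
      refine ⟨r, hr, _, ⟨sphereIsometry f.symm y, ?_, rfl⟩, ?_⟩
      · simpa [sphereIsometry] using hy
      · apply f.injective
        simp [sphereIsometry, ← h]
  rw [hset]
  exact f.measurePreserving.measure_preimage_emb f.toHomeomorph.measurableEmbedding _

/-- The reflection in the hyperplane orthogonal to `y - z` carries `y` to `z` and preserves the
measure. -/
lemma integral_inner_eq {d : ℕ} {g : ℝ → ℝ} (hg : Continuous g) (y z : UnitSphere d) :
    ∫ x, g ⟪(x : EuclideanSpace ℝ (Fin (d + 1))), y⟫ ∂uniformMeasure d =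
      ∫ x, g ⟪(x : EuclideanSpace ℝ (Fin (d + 1))), z⟫ ∂uniformMeasure d := by
  set f := (Submodule.reflection
    (ℝ ∙ ((y : EuclideanSpace ℝ (Fin (d + 1))) - z))ᗮ)
  have hf : f y = z := Submodule.reflection_sub (by simp)
  have hc : Continuous fun x : UnitSphere d =>
      g ⟪(x : EuclideanSpace ℝ (Fin (d + 1))), z⟫ := by fun_prop
  conv_rhs => rw [← map_sphereIsometry_uniformMeasure f]
  rw [integral_map (continuous_sphereIsometry f).aemeasurable hc.aestronglyMeasurable]
  refine integral_congr_ae (Eventually.of_forall fun x => ?_)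
  simp only [sphereIsometry]
  rw [← hf, f.inner_map_map]

lemma norm_sub_rpow_eq {d : ℕ} (lam : ℝ) (x y : UnitSphere d) :
    ‖(x : EuclideanSpace ℝ (Fin (d + 1))) - y‖ ^ lam =
      (2 - 2 * ⟪(x : EuclideanSpace ℝ (Fin (d + 1))), y⟫) ^ (lam / 2) := by
  have h := norm_sub_sq_real (x : EuclideanSpace ℝ (Fin (d + 1))) y
  rw [norm_eq_of_mem_sphere x, norm_eq_of_mem_sphere y] at h
  rw [show 2 - 2 * ⟪(x : EuclideanSpace ℝ (Fin (d + 1))), y⟫ =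
      ‖(x : EuclideanSpace ℝ (Fin (d + 1))) - y‖ ^ 2 by rw [h]; ring,
    ← Real.rpow_natCast, ← Real.rpow_mul (norm_nonneg _)]
  congr 1
  push_cast
  ring

lemma contEnergy_eq_integral {d : ℕ} {lam : ℝ} (hlam : 0 < lam) (y : UnitSphere d) :
    contEnergy lam (uniformMeasure d) =
      ∫ x, (2 - 2 * ⟪(x : EuclideanSpace ℝ (Fin (d + 1))), y⟫) ^ (lam / 2)
        ∂uniformMeasure d := by
  have hc : Continuous fun t : ℝ => (2 - 2 * t) ^ (lam / 2) :=
    Continuous.rpow_const (by fun_prop) fun _ => Or.inr (by positivity)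
  simp only [contEnergy, norm_sub_rpow_eq]
  rw [integral_congr_ae (Eventually.of_forall fun z => integral_inner_eq hc z y)]
  simp

lemma abs_inner_sphere_le {d : ℕ} (x y : UnitSphere d) :
    |⟪(x : EuclideanSpace ℝ (Fin (d + 1))), y⟫| ≤ 1 := by
  simpa using abs_real_inner_le_norm (x : EuclideanSpace ℝ (Fin (d + 1))) y

lemma integrable_of_continuous_sphere {d : ℕ} {g : UnitSphere d → ℝ} (hg : Continuous g) :
    Integrable g (uniformMeasure d) := by
  simpa using hg.continuousOn.integrableOn_compact (μ := uniformMeasure d) isCompact_univ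

end Rotation

/-! ### Discrete energy against uniform energy -/

section EnergyInequality

open scoped RealInnerProductSpace

lemma inner_pow_eq_sum {m : ℕ} (k : ℕ) (x y : EuclideanSpace ℝ (Fin m)) :
    ⟪x, y⟫ ^ k = ∑ J : Fin k → Fin m, (∏ j, x (J j)) * ∏ j, y (J j) := by
  have h : ⟪x, y⟫ = ∑ i, x i * y i := by
    simp [PiLp.inner_apply, mul_comm]
  rw [h, Finset.sum_pow']
  simp [Fintype.piFinset_univ, Finset.prod_mul_distrib]

/-- Expand `∑ (∑ φ_J(a i) - N c_J)² ≥ 0` over the degree `k` monomials `φ_J` with means `c_J`.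
Constancy of the uniform potential makes the cross term `N M` and `∑ c_J² = M`. -/
lemma sq_mul_integral_inner_pow_le {d : ℕ} (k N : ℕ) (a : ℕ → UnitSphere d)
    (e : UnitSphere d) :
    (N : ℝ) ^ 2 * ∫ x, ⟪(x : EuclideanSpace ℝ (Fin (d + 1))), e⟫ ^ k ∂uniformMeasure d ≤
      ∑ i ∈ Finset.range N, ∑ j ∈ Finset.range N,
        ⟪(a i : EuclideanSpace ℝ (Fin (d + 1))), a j⟫ ^ k := by
  set M := ∫ x, ⟪(x : EuclideanSpace ℝ (Fin (d + 1))), e⟫ ^ k ∂uniformMeasure d with hM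
  let φ : (Fin k → Fin (d + 1)) → UnitSphere d → ℝ := fun J x =>
    ∏ j, (x : EuclideanSpace ℝ (Fin (d + 1))) (J j)
  have hφc : ∀ J, Continuous (φ J) := fun J => by
    simp only [φ]
    fun_prop
  have hφi : ∀ J, Integrable (φ J) (uniformMeasure d) := fun J =>
    integrable_of_continuous_sphere (hφc J)
  let c : (Fin k → Fin (d + 1)) → ℝ := fun J => ∫ x, φ J x ∂uniformMeasure d
  have hP : ∀ y : UnitSphere d, ∑ J, c J * φ J y = M := by
    intro y
    rw [hM, integral_inner_eq (continuous_pow k) e y]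
    simp_rw [inner_pow_eq_sum]
    rw [integral_finsetSum _ fun J _ => (hφi J).mul_const _]
    exact Finset.sum_congr rfl fun J _ => (integral_mul_const _ _).symm
  have hcc : ∑ J, c J * c J = M := by
    calc ∑ J, c J * c J = ∑ J, ∫ y, c J * φ J y ∂uniformMeasure d := by
          simp only [integral_const_mul, c]
      _ = ∫ y, ∑ J, c J * φ J y ∂uniformMeasure d :=
          (integral_finsetSum _ fun J _ => (hφi J).const_mul _).symm
      _ = M := by simp [hP]
  have hcross : ∑ J, c J * ∑ i ∈ Finset.range N, φ J (a i) = N * M := by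
    simp_rw [Finset.mul_sum]
    rw [Finset.sum_comm]
    simp [hP]
  have hdisc : ∑ J, (∑ i ∈ Finset.range N, φ J (a i)) ^ 2 =
      ∑ i ∈ Finset.range N, ∑ j ∈ Finset.range N,
        ⟪(a i : EuclideanSpace ℝ (Fin (d + 1))), a j⟫ ^ k := by
    simp_rw [inner_pow_eq_sum, sq, Finset.sum_mul_sum]
    rw [Finset.sum_comm]
    exact Finset.sum_congr rfl fun i _ => Finset.sum_comm
  have hsq : 0 ≤ ∑ J, (∑ i ∈ Finset.range N, φ J (a i) - N * c J) ^ 2 :=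
    Finset.sum_nonneg fun _ _ => sq_nonneg _
  have hexp : ∑ J, (∑ i ∈ Finset.range N, φ J (a i) - N * c J) ^ 2 =
      ∑ J, (∑ i ∈ Finset.range N, φ J (a i)) ^ 2
        - 2 * N * ∑ J, c J * ∑ i ∈ Finset.range N, φ J (a i)
        + N ^ 2 * ∑ J, c J * c J := by
    rw [Finset.mul_sum, Finset.mul_sum, ← Finset.sum_sub_distrib, ← Finset.sum_add_distrib]
    exact Finset.sum_congr rfl fun J _ => by ring
  rw [hexp, hdisc, hcross, hcc] at hsq
  linarith

/-- The zonal kernel `g ⟪x, y⟫` has, on the first `N` points of `a`, at most the energy that it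
has on the uniform measure. -/
def ZonalEnergyLE {d : ℕ} (N : ℕ) (a : ℕ → UnitSphere d) (e : UnitSphere d) (g : ℝ → ℝ) : Prop :=
  ∑ i ∈ Finset.range N, ∑ j ∈ Finset.range N,
      g ⟪(a i : EuclideanSpace ℝ (Fin (d + 1))), a j⟫ ≤
    (N : ℝ) ^ 2 * ∫ x, g ⟪(x : EuclideanSpace ℝ (Fin (d + 1))), e⟫ ∂uniformMeasure d

variable {d : ℕ} {N : ℕ} {a : ℕ → UnitSphere d} {e : UnitSphere d}

lemma zonalEnergyLE_polynomial {b : ℕ → ℝ} (hb : ∀ k, 1 ≤ k → b k ≤ 0) (m : ℕ) :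
    ZonalEnergyLE N a e fun t => ∑ k ∈ Finset.range m, b k * t ^ k := by
  have hi : ∀ k, Integrable (fun x : UnitSphere d =>
      ⟪(x : EuclideanSpace ℝ (Fin (d + 1))), e⟫ ^ k) (uniformMeasure d) := fun k =>
    integrable_of_continuous_sphere (by fun_prop)
  unfold ZonalEnergyLE
  rw [integral_finsetSum _ fun k _ => (hi k).const_mul _]
  simp_rw [integral_const_mul, Finset.mul_sum]
  calc _ = ∑ k ∈ Finset.range m, b k * ∑ i ∈ Finset.range N, ∑ j ∈ Finset.range N,
        ⟪(a i : EuclideanSpace ℝ (Fin (d + 1))), a j⟫ ^ k := by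
        simp_rw [Finset.mul_sum]
        rw [Finset.sum_comm]
        refine (Finset.sum_congr rfl fun j _ => Finset.sum_comm).trans ?_
        rw [Finset.sum_comm]
        exact Finset.sum_congr rfl fun k _ => Finset.sum_comm
    _ ≤ _ := Finset.sum_le_sum fun k _ => ?_
  rcases Nat.eq_zero_or_pos k with rfl | hk
  · simp
    apply le_of_eq
    ring
  · rw [mul_left_comm]
    exact mul_le_mul_of_nonpos_left (sq_mul_integral_inner_pow_le k N a e) (hb k hk)

lemma ZonalEnergyLE.of_tendsto {G : ℕ → ℝ → ℝ} {g : ℝ → ℝ} {C : ℝ}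
    (hc : ∀ m, Continuous (G m)) (hC : ∀ m t, |t| ≤ 1 → |G m t| ≤ C)
    (hlim : ∀ t, |t| ≤ 1 → Tendsto (fun m => G m t) atTop (𝓝 (g t)))
    (h : ∀ m, ZonalEnergyLE N a e (G m)) : ZonalEnergyLE N a e g := by
  refine le_of_tendsto_of_tendsto'
    (tendsto_finsetSum _ fun i _ => tendsto_finsetSum _ fun j _ =>
      hlim _ (abs_inner_sphere_le (a i) (a j)))
    (Tendsto.const_mul _ ?_) h
  refine tendsto_integral_of_dominated_convergence (fun _ => C) (fun m => ?_)
    (integrable_const _) (fun m => ?_) ?_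
  · exact ((hc m).comp (by fun_prop)).aestronglyMeasurable
  · exact Eventually.of_forall fun x => hC m _ (abs_inner_sphere_le x e)
  · exact Eventually.of_forall fun x => hlim _ (abs_inner_sphere_le x e)

lemma succ_mul_ringChoose_succ (α : ℝ) (k : ℕ) :
    ((k : ℝ) + 1) * Ring.choose α (k + 1) = (α - k) * Ring.choose α k := by
  have h0 := Ring.descPochhammer_eq_factorial_smul_choose α k
  have h1 := Ring.descPochhammer_eq_factorial_smul_choose α (k + 1)
  rw [descPochhammer_succ_right, Polynomial.smeval_mul, h0, Nat.factorial_succ] at h1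
  simp only [nsmul_eq_mul, Polynomial.smeval_sub, Polynomial.smeval_X,
    Polynomial.smeval_natCast, pow_one, pow_zero, Nat.cast_mul, Nat.cast_add, Nat.cast_one,
    mul_one] at h1
  have hk : (k.factorial : ℝ) ≠ 0 := by exact_mod_cast k.factorial_ne_zero
  apply mul_left_cancel₀ hk
  linear_combination -h1

/-- The signed coefficients satisfy `(k + 1) c_{k+1} = (k - α) c_k`, and `k - α ≥ 0` for `k ≥ 1`, so
the sign of `c_1 = -α` persists. -/
lemma neg_one_pow_mul_ringChoose_nonpos {α : ℝ} (h0 : 0 ≤ α) (h1 : α ≤ 1) :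
    ∀ k : ℕ, 1 ≤ k → (-1) ^ k * Ring.choose α k ≤ 0 := by
  intro k hk
  induction k, hk using Nat.le_induction with
  | base => simpa using h0
  | succ k hk ih =>
    have h := succ_mul_ringChoose_succ α k
    have hk' : (1 : ℝ) ≤ k := by exact_mod_cast hk
    have h2 : ((k : ℝ) + 1) * ((-1) ^ (k + 1) * Ring.choose α (k + 1)) =
        (k - α) * ((-1) ^ k * Ring.choose α k) := by
      rw [pow_succ]
      linear_combination -((-1) ^ k) * h
    have h3 : (k - α) * ((-1) ^ k * Ring.choose α k) ≤ 0 :=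
      mul_nonpos_of_nonneg_of_nonpos (by linarith) ih
    by_contra! hpos
    have := mul_pos (by linarith : (0 : ℝ) < k + 1) hpos
    linarith

lemma hasSum_one_sub_rpow (α : ℝ) {t : ℝ} (ht : |t| < 1) :
    HasSum (fun k : ℕ => (-1) ^ k * Ring.choose α k * t ^ k) ((1 - t) ^ α) := by
  have h := (Real.one_add_rpow_hasFPowerSeriesOnBall_zero (a := α)).hasSum
    (y := -t) (by
      rw [← ENNReal.ofReal_one, Metric.eball_ofReal]
      simpa using ht)
  rw [zero_add, ← sub_eq_add_neg] at h
  refine h.congr_fun fun k => ?_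
  simp only [binomialSeries_apply, List.ofFn_const, List.prod_replicate, smul_eq_mul]
  rw [neg_pow]
  ring

/-- The damping `r < 1` makes the series converge absolutely and uniformly on `|t| ≤ 1`, endpoints
included; `r → 1` is taken afterwards. -/
lemma zonalEnergyLE_one_sub_mul_rpow {α : ℝ} (h0 : 0 ≤ α) (h1 : α ≤ 1) {r : ℝ} (hr0 : 0 ≤ r)
    (hr1 : r < 1) : ZonalEnergyLE N a e fun t => (1 - r * t) ^ α := by
  let b : ℕ → ℝ := fun k => (-1) ^ k * Ring.choose α k * r ^ k
  have hsum : Summable b := (hasSum_one_sub_rpow α (by rwa [abs_of_nonneg hr0])).summable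
  refine ZonalEnergyLE.of_tendsto (G := fun m t => ∑ k ∈ Finset.range m, b k * t ^ k)
    (C := ∑' k, |b k|) (fun m => by fun_prop) (fun m t ht => ?_) (fun t ht => ?_)
    (fun m => zonalEnergyLE_polynomial (fun k hk => mul_nonpos_of_nonpos_of_nonneg
      (neg_one_pow_mul_ringChoose_nonpos h0 h1 k hk) (by positivity)) m)
  · refine (Finset.abs_sum_le_sum_abs _ _).trans ((Finset.sum_le_sum fun k _ => ?_).trans
      (hsum.abs.sum_le_tsum _ fun _ _ => abs_nonneg _))
    rw [abs_mul, abs_pow]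
    exact mul_le_of_le_one_right (abs_nonneg _) (pow_le_one₀ (abs_nonneg _) ht)
  · have hrt : |r * t| < 1 := by
      rw [abs_mul, abs_of_nonneg hr0]
      exact (mul_le_of_le_one_right hr0 ht).trans_lt hr1
    have := (hasSum_one_sub_rpow α hrt).tendsto_sum_nat
    simpa only [b, mul_pow, mul_assoc] using this

lemma zonalEnergyLE_two_sub_rpow {α : ℝ} (h0 : 0 < α) (h1 : α ≤ 1) :
    ZonalEnergyLE N a e fun t => (2 - 2 * t) ^ α := by
  have key : ZonalEnergyLE N a e fun t => (1 - t) ^ α := by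
    have hr : ∀ m : ℕ, 0 ≤ 1 - 1 / ((m : ℝ) + 1) ∧ 1 - 1 / ((m : ℝ) + 1) < 1 := fun m => by
      have h : 1 / ((m : ℝ) + 1) ≤ 1 := by
        rw [div_le_one (by positivity)]
        linarith [(Nat.cast_nonneg m : (0 : ℝ) ≤ m)]
      exact ⟨by linarith, by linarith [(by positivity : 0 < 1 / ((m : ℝ) + 1))]⟩
    refine ZonalEnergyLE.of_tendsto
      (G := fun m t => (1 - (1 - 1 / ((m : ℝ) + 1)) * t) ^ α) (C := 2 ^ α)
      (fun m => Continuous.rpow_const (by fun_prop) fun _ => Or.inr h0.le) (fun m t ht => ?_)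
      (fun t _ => ?_) (fun m => zonalEnergyLE_one_sub_mul_rpow h0.le h1 (hr m).1 (hr m).2)
    · have hrt : |(1 - 1 / ((m : ℝ) + 1)) * t| ≤ 1 := by
        rw [abs_mul, abs_of_nonneg (hr m).1]
        exact mul_le_one₀ (hr m).2.le (abs_nonneg _) ht
      have := abs_le.1 hrt
      rw [abs_of_nonneg (Real.rpow_nonneg (by linarith) _)]
      exact Real.rpow_le_rpow (by linarith) (by linarith) h0.le
    · have h := tendsto_one_div_add_atTop_nhds_zero_nat (𝕜 := ℝ)
      have h' : Tendsto (fun m : ℕ => 1 - (1 - 1 / ((m : ℝ) + 1)) * t) atTop (𝓝 (1 - t)) := by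
        simpa using ((h.const_sub 1).mul_const t).const_sub 1
      exact h'.rpow_const (Or.inr h0.le)
  have hfac : ∀ t : ℝ, |t| ≤ 1 → (2 - 2 * t) ^ α = 2 ^ α * (1 - t) ^ α := fun t ht => by
    rw [← Real.mul_rpow (by norm_num) (by linarith [(abs_le.1 ht).2])]
    ring_nf
  unfold ZonalEnergyLE at key ⊢
  simp_rw [fun i j => hfac _ (abs_inner_sphere_le (a i) (a j)),
    fun x => hfac _ (abs_inner_sphere_le x e), integral_const_mul, ← Finset.mul_sum]
  rw [mul_left_comm]
  exact mul_le_mul_of_nonneg_left key (by positivity)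

lemma sum_norm_sub_rpow_le_contEnergy {lam : ℝ} (h0 : 0 < lam) (h2 : lam ≤ 2) (N : ℕ)
    (a : ℕ → UnitSphere d) :
    ∑ i ∈ Finset.range N, ∑ j ∈ Finset.range N,
        ‖(a i : EuclideanSpace ℝ (Fin (d + 1))) - a j‖ ^ lam ≤
      (N : ℝ) ^ 2 * contEnergy lam (uniformMeasure d) := by
  rw [contEnergy_eq_integral h0 (a 0)]
  simp_rw [norm_sub_rpow_eq]
  exact zonalEnergyLE_two_sub_rpow (by positivity) (by linarith)

end EnergyInequality

/-! ### Nonconstancy of the potentials -/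

section Nonconstant

open scoped RealInnerProductSpace

/-- Bernoulli for the exponent `1 - α` gives `z ^ (1 - α) ≤ 1 + w`; invert using `1 / (1 + w) ≥ 1 -
w` and multiply by `z`. -/
lemma quadratic_le_rpow {α z : ℝ} (h0 : 0 ≤ α) (h1 : α ≤ 1) (hz : 0 < z) :
    1 + α * (z - 1) - (1 - α) * (z - 1) ^ 2 ≤ z ^ α := by
  have hb : z ^ (1 - α) ≤ 1 + (1 - α) * (z - 1) := by
    simpa using rpow_one_add_le_one_add_mul_self (s := z - 1) (by linarith)
      (by linarith : 0 ≤ 1 - α) (by linarith)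
  have hp : 0 < z ^ (1 - α) := Real.rpow_pos_of_pos hz _
  have hmul : z ^ α * z ^ (1 - α) = z := by
    rw [← Real.rpow_add hz]
    simp
  set w := (1 - α) * (z - 1) with hw
  have hinv : 1 - w ≤ (z ^ (1 - α))⁻¹ := by
    rw [← one_div, le_div_iff₀ hp]
    rcases le_total (1 - w) 0 with h | h
    · nlinarith
    · nlinarith [sq_nonneg w]
  have heq : z ^ α = z * (z ^ (1 - α))⁻¹ := by
    rw [← div_eq_mul_inv, eq_div_iff hp.ne', hmul]
  rw [heq]
  have := mul_le_mul_of_nonneg_left hinv hz.le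
  rw [hw] at this
  linarith

lemma rpow_sub_quadratic_le_rpow {α s t : ℝ} (h0 : 0 < α) (h1 : α ≤ 1) (hs : 0 < s)
    (ht : 0 ≤ t) :
    s ^ α + α * s ^ α / s * (t - s) - (1 - α) * s ^ α / s ^ 2 * (t - s) ^ 2 ≤ t ^ α := by
  have hsa : 0 < s ^ α := Real.rpow_pos_of_pos hs _
  rcases ht.eq_or_lt with rfl | ht
  · rw [Real.zero_rpow h0.ne']
    apply le_of_eq
    field_simp
    ring
  · have h := mul_le_mul_of_nonneg_left (quadratic_le_rpow h0.le h1 (div_pos ht hs)) hsa.le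
    rw [← Real.mul_rpow hs.le (div_pos ht hs).le, mul_div_cancel₀ _ hs.ne'] at h
    refine le_trans (le_of_eq ?_) h
    field_simp

lemma exists_second_difference_bound {α A B : ℝ} (h0 : 0 < α) (h1 : α ≤ 1) (hA : |A| ≤ 1)
    (hB : |B| ≤ 1) (hA1 : A < 1) :
    ∃ C : ℝ, ∀ τ c : ℝ, 0 ≤ τ → τ ≤ 1 → 1 - τ ^ 2 ≤ c → c ≤ 1 →
      0 ≤ 2 - 2 * (c * A + τ * B) → 0 ≤ 2 - 2 * (c * A - τ * B) →
      2 * (2 - 2 * A) ^ α - C * τ ^ 2 ≤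
        (2 - 2 * (c * A + τ * B)) ^ α + (2 - 2 * (c * A - τ * B)) ^ α := by
  set s := 2 - 2 * A with hs
  have hs0 : 0 < s := by linarith
  have hsa : 0 < s ^ α := Real.rpow_pos_of_pos hs0 _
  set p := α * s ^ α / s with hp
  set q := (1 - α) * s ^ α / s ^ 2 with hq
  have hp0 : 0 ≤ p := by positivity
  have hq0 : 0 ≤ q := div_nonneg (mul_nonneg (by linarith) hsa.le) (by positivity)
  -- The terms `±τ B` cancel to first order, leaving `4 p A (1 - c) ≥ -4 p τ²`; both increments are
  -- at most `4 τ` in size, costing `2 · 16 q τ²`.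
  refine ⟨4 * p + 32 * q, fun τ c hτ0 hτ1 hc0 hc1 hplus hminus => ?_⟩
  have e1 := rpow_sub_quadratic_le_rpow h0 h1 hs0 hplus
  have e2 := rpow_sub_quadratic_le_rpow h0 h1 hs0 hminus
  obtain ⟨hA2, hA3⟩ := abs_le.1 hA
  obtain ⟨hB2, hB3⟩ := abs_le.1 hB
  have hττ : τ ^ 2 ≤ τ := by nlinarith
  have k1 : |A * (1 - c)| ≤ τ ^ 2 := by
    rw [abs_mul, abs_of_nonneg (by linarith : 0 ≤ 1 - c)]
    exact (mul_le_of_le_one_left (by linarith) hA).trans (by linarith)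
  have k2 : |τ * B| ≤ τ := by
    rw [abs_mul, abs_of_nonneg hτ0]
    exact mul_le_of_le_one_right hτ0 hB
  obtain ⟨k3, k4⟩ := abs_le.1 k1
  obtain ⟨k5, k6⟩ := abs_le.1 k2
  have l1 : (2 - 2 * (c * A + τ * B) - s) ^ 2 ≤ (4 * τ) ^ 2 :=
    sq_le_sq' (by linarith) (by linarith)
  have l2 : (2 - 2 * (c * A - τ * B) - s) ^ 2 ≤ (4 * τ) ^ 2 :=
    sq_le_sq' (by linarith) (by linarith)
  have m1 := mul_le_mul_of_nonneg_left l1 hq0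
  have m2 := mul_le_mul_of_nonneg_left l2 hq0
  have m3 := mul_le_mul_of_nonneg_left k3 hp0
  have m4 : p * (2 - 2 * (c * A + τ * B) - s) + p * (2 - 2 * (c * A - τ * B) - s) =
      4 * (p * (A * (1 - c))) := by
    rw [hs]
    ring
  nlinarith

lemma exists_unit_orthogonal {d : ℕ} (hd : 1 ≤ d) (p : EuclideanSpace ℝ (Fin (d + 1))) :
    ∃ e : EuclideanSpace ℝ (Fin (d + 1)), ‖e‖ = 1 ∧ ⟪e, p⟫ = 0 := by
  obtain ⟨v, hv, hv0⟩ : ∃ v ∈ (ℝ ∙ p)ᗮ, v ≠ 0 := by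
    apply Submodule.exists_mem_ne_zero_of_ne_bot
    intro hbot
    have h1 := (ℝ ∙ p).finrank_add_finrank_orthogonal
    have h2 := finrank_span_le_card (R := ℝ) ({p} : Set (EuclideanSpace ℝ (Fin (d + 1))))
    rw [hbot, finrank_bot, finrank_euclideanSpace_fin] at h1
    rw [Set.toFinset_singleton, Finset.card_singleton] at h2
    omega
  refine ⟨(‖v‖⁻¹ : ℝ) • v, by simp [norm_smul, hv0], ?_⟩
  rw [inner_smul_left, Submodule.mem_orthogonal_singleton_iff_inner_left.1 hv, mul_zero]

lemma smul_add_smul_mem_sphere {d : ℕ} {p e : EuclideanSpace ℝ (Fin (d + 1))} (hp : ‖p‖ = 1)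
    (he : ‖e‖ = 1) (hep : ⟪e, p⟫ = 0) {τ c : ℝ} (hc : c ^ 2 + τ ^ 2 = 1) :
    c • p + τ • e ∈ Metric.sphere (0 : EuclideanSpace ℝ (Fin (d + 1))) 1 := by
  have h : ‖c • p + τ • e‖ ^ 2 = 1 := by
    rw [norm_add_sq_real, inner_smul_left, inner_smul_right, real_inner_comm, hep, norm_smul,
      norm_smul, hp, he]
    simpa using hc
  simpa using (pow_eq_one_iff_of_nonneg (norm_nonneg _) two_ne_zero).1 h

lemma not_exists_forall_discretePotential_eq {d : ℕ} (hd : 1 ≤ d) {lam : ℝ} (h0 : 0 < lam)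
    (h2 : lam < 2) (a : ℕ → UnitSphere d) {n : ℕ} (hn : 1 ≤ n) :
    ¬ ∃ c : ℝ, ∀ x : UnitSphere d, discretePotential lam a n x = c := by
  rintro ⟨K, hK⟩
  set α := lam / 2 with hα
  have hα0 : 0 < α := by positivity
  have hα1 : α ≤ 1 := by linarith
  obtain ⟨e, he, hep⟩ := exists_unit_orthogonal hd (a 0 : EuclideanSpace ℝ (Fin (d + 1)))
  have hp : ‖(a 0 : EuclideanSpace ℝ (Fin (d + 1)))‖ = 1 := by simp
  let A : ℕ → ℝ := fun k => ⟪(a 0 : EuclideanSpace ℝ (Fin (d + 1))), a k⟫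
  let B : ℕ → ℝ := fun k => ⟪e, (a k : EuclideanSpace ℝ (Fin (d + 1)))⟫
  have hA : ∀ k, |A k| ≤ 1 := fun k => abs_inner_sphere_le _ _
  have hB : ∀ k, |B k| ≤ 1 := fun k =>
    abs_inner_sphere_le (⟨e, by simpa using he⟩ : UnitSphere d) (a k)
  have hb : ∀ k, ∃ C : ℝ, ∀ τ c : ℝ, 0 ≤ τ → τ ≤ 1 → 1 - τ ^ 2 ≤ c → c ≤ 1 →
      0 ≤ 2 - 2 * (c * A k + τ * B k) → 0 ≤ 2 - 2 * (c * A k - τ * B k) →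
      2 * (2 - 2 * A k) ^ α - C * τ ^ 2 ≤
        (2 - 2 * (c * A k + τ * B k)) ^ α + (2 - 2 * (c * A k - τ * B k)) ^ α := by
    intro k
    rcases (abs_le.1 (hA k)).2.lt_or_eq with h | h
    · exact exists_second_difference_bound hα0 hα1 (hA k) (hB k) h
    -- Here `a k = a 0`: the kernel vanishes at the centre, so the second difference is nonnegative.
    · refine ⟨0, fun τ c _ _ _ _ h3 h4 => ?_⟩
      rw [h, mul_one, sub_self, Real.zero_rpow hα0.ne', mul_zero, zero_mul, sub_zero]
      exact add_nonneg (Real.rpow_nonneg (by rw [h] at h3; linarith) _)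
        (Real.rpow_nonneg (by rw [h] at h4; linarith) _)
  choose C hC using hb
  set D := ∑ k ∈ Finset.range n, |C k|
  -- Compare `a 0` with the two points `c • a 0 ± τ • e` on a great circle through it. A constant
  -- potential has zero second difference.
  have key : ∀ τ : ℝ, 0 < τ → τ ≤ 1 → 2 * τ ^ lam ≤ D * τ ^ 2 := by
    intro τ hτ0 hτ1
    set c := √(1 - τ ^ 2) with hc
    have hτ2 : 0 ≤ 1 - τ ^ 2 := by nlinarith
    have hcsq : c ^ 2 = 1 - τ ^ 2 := Real.sq_sqrt hτ2
    have hc0 : 0 ≤ c := Real.sqrt_nonneg _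
    have hc1 : c ≤ 1 := by nlinarith
    have hcl : 1 - τ ^ 2 ≤ c := by nlinarith
    let x : UnitSphere d := ⟨c • (a 0 : EuclideanSpace ℝ (Fin (d + 1))) + τ • e,
      smul_add_smul_mem_sphere hp he hep (by linarith)⟩
    let y : UnitSphere d := ⟨c • (a 0 : EuclideanSpace ℝ (Fin (d + 1))) + (-τ) • e,
      smul_add_smul_mem_sphere hp he hep (by linarith)⟩
    have hx : ∀ k, ⟪(x : EuclideanSpace ℝ (Fin (d + 1))), a k⟫ = c * A k + τ * B k := by
      intro k
      simp [x, A, B, inner_add_left, inner_smul_left]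
    have hy : ∀ k, ⟪(y : EuclideanSpace ℝ (Fin (d + 1))), a k⟫ = c * A k - τ * B k := by
      intro k
      simp [y, A, B, inner_add_left, inner_smul_left, sub_eq_add_neg]
    have hsum : discretePotential lam a n x + discretePotential lam a n y =
        2 * discretePotential lam a n (a 0) := by
      rw [hK, hK, hK]
      ring
    simp only [discretePotential, norm_sub_rpow_eq, hx, hy, ← hα] at hsum
    rw [← Finset.sum_add_distrib, Finset.mul_sum] at hsum
    have hA0 : A 0 = 1 := by simp [A]
    have hB0 : B 0 = 0 := by simpa [B] using hep
    have hle : ∑ k ∈ Finset.range n, (2 * (2 - 2 * A k) ^ α - |C k| * τ ^ 2 +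
        if k = 0 then 2 * τ ^ lam else 0) ≤
        ∑ k ∈ Finset.range n, ((2 - 2 * (c * A k + τ * B k)) ^ α +
          (2 - 2 * (c * A k - τ * B k)) ^ α) := by
      refine Finset.sum_le_sum fun k _ => ?_
      have hx' := (abs_le.1 (abs_inner_sphere_le x (a k))).2
      have hy' := (abs_le.1 (abs_inner_sphere_le y (a k))).2
      rw [hx] at hx'
      rw [hy] at hy'
      split_ifs with hk
      · subst hk
        have hτl : τ ^ lam = (τ ^ 2) ^ α := by
          rw [← Real.rpow_natCast, ← Real.rpow_mul hτ0.le, hα]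
          congr 1
          push_cast
          ring
        have hge : τ ^ lam ≤ (2 - 2 * c) ^ α := by
          rw [hτl]
          exact Real.rpow_le_rpow (by positivity) (by nlinarith [sq_nonneg (c - 1)]) hα0.le
        have hnn : 0 ≤ |C 0| * τ ^ 2 := by positivity
        rw [hA0, hB0]
        simp only [mul_one, mul_zero, add_zero, sub_zero, sub_self, Real.zero_rpow hα0.ne']
        linarith
      · have h1 := hC k τ c hτ0.le hτ1 hcl hc1 (by linarith) (by linarith)
        have h3 := mul_le_mul_of_nonneg_right (le_abs_self (C k)) (sq_nonneg τ)
        linarith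
    rw [Finset.sum_add_distrib, Finset.sum_sub_distrib, ← Finset.sum_mul, hsum] at hle
    rw [Finset.sum_ite_eq' (Finset.range n) 0, if_pos (Finset.mem_range.2 hn)] at hle
    change _ - D * τ ^ 2 + _ ≤ _ at hle
    linarith
  have hlim : Tendsto (fun τ : ℝ => D * τ ^ (2 - lam)) (𝓝[>] 0) (𝓝 0) := by
    have h : Tendsto (fun τ : ℝ => D * τ ^ (2 - lam)) (𝓝 0) (𝓝 (D * 0 ^ (2 - lam))) :=
      ((Real.continuous_rpow_const (by linarith)).tendsto 0).const_mul D
    rw [Real.zero_rpow (by linarith), mul_zero] at h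
    exact h.mono_left nhdsWithin_le_nhds
  -- Divide `key` by `τ ^ lam` and let `τ → 0`.
  have hge : (2 : ℝ) ≤ 0 := by
    refine ge_of_tendsto hlim ?_
    filter_upwards [Ioc_mem_nhdsGT (zero_lt_one : (0 : ℝ) < 1)] with τ hτ
    have h := key τ hτ.1 hτ.2
    have h3 : τ ^ 2 = τ ^ (2 - lam) * τ ^ lam := by
      rw [← Real.rpow_add hτ.1, sub_add_cancel]
      exact (Real.rpow_natCast τ 2).symm
    rw [h3, ← mul_assoc] at h
    exact le_of_mul_le_mul_right h (Real.rpow_pos_of_pos hτ.1 _)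
  norm_num at hge

end Nonconstant

/-! ### Greedy sequences: antipodal pairs, mean values and the limit -/

section Greedy

variable {d : ℕ} {lam : ℝ} {a : ℕ → UnitSphere d}

lemma continuous_discretePotential (h0 : 0 < lam) (n : ℕ) :
    Continuous (discretePotential lam a n) := by
  unfold discretePotential
  exact continuous_finsetSum _ fun k _ =>
    Continuous.rpow_const (by fun_prop) fun _ => Or.inr h0.le

lemma discretePotential_succ (n : ℕ) (x : UnitSphere d) :
    discretePotential lam a (n + 1) x = discretePotential lam a n x +
      ‖(x : EuclideanSpace ℝ (Fin (d + 1))) - a n‖ ^ lam :=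
  Finset.sum_range_succ _ _

lemma discretePotential_succ_self (h0 : 0 < lam) (n : ℕ) :
    discretePotential lam a (n + 1) (a n) = discretePotential lam a n (a n) := by
  rw [discretePotential_succ, sub_self, norm_zero, Real.zero_rpow h0.ne', add_zero]

lemma IsGreedyEnergySequence.le (ha : IsGreedyEnergySequence lam a) (n : ℕ) (x : UnitSphere d) :
    discretePotential lam a n x ≤ discretePotential lam a n (a n) := by
  rcases Nat.eq_zero_or_pos n with rfl | hn
  · simp [discretePotential]
  · exact (ha n hn).2 ⟨x, rfl⟩

lemma norm_sub_rpow_le_two_rpow (h0 : 0 < lam) (x y : UnitSphere d) :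
    ‖(x : EuclideanSpace ℝ (Fin (d + 1))) - y‖ ^ lam ≤ 2 ^ lam := by
  refine Real.rpow_le_rpow (norm_nonneg _) ?_ h0.le
  refine (norm_sub_le _ _).trans ?_
  rw [norm_eq_of_mem_sphere, norm_eq_of_mem_sphere]
  norm_num

lemma norm_neg_sub_rpow (x : UnitSphere d) :
    ‖((-x : UnitSphere d) : EuclideanSpace ℝ (Fin (d + 1))) - x‖ ^ lam = 2 ^ lam := by
  congr 1
  rw [show ((-x : UnitSphere d) : EuclideanSpace ℝ (Fin (d + 1))) - x =
    (-2 : ℝ) • (x : EuclideanSpace ℝ (Fin (d + 1))) by rw [coe_neg_sphere]; module, norm_smul,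
    norm_eq_of_mem_sphere]
  norm_num

lemma eq_neg_of_two_rpow_le (h0 : 0 < lam) {x y : UnitSphere d}
    (h : 2 ^ lam ≤ ‖(x : EuclideanSpace ℝ (Fin (d + 1))) - y‖ ^ lam) : x = -y := by
  have h2 : 2 ≤ ‖(x : EuclideanSpace ℝ (Fin (d + 1))) - y‖ :=
    (Real.rpow_le_rpow_iff (by norm_num) (norm_nonneg _) h0).1 h
  have hpar := parallelogram_law_with_norm ℝ (x : EuclideanSpace ℝ (Fin (d + 1))) y
  rw [norm_eq_of_mem_sphere, norm_eq_of_mem_sphere] at hpar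
  have hz : ‖(x : EuclideanSpace ℝ (Fin (d + 1))) + y‖ = 0 := by nlinarith
  exact Subtype.ext (eq_neg_of_add_eq_zero_left (norm_eq_zero.1 hz))

/-- The points of a greedy sequence come in antipodal pairs, so that the potentials with an even
number of terms are even functions. -/
lemma IsGreedyEnergySequence.antipodal (h0 : 0 < lam) (ha : IsGreedyEnergySequence lam a)
    (k : ℕ) :
    (∀ x, discretePotential lam a (2 * k) (-x) = discretePotential lam a (2 * k) x) ∧
      a (2 * k + 1) = -a (2 * k) := by
  have odd : ∀ k, (∀ x, discretePotential lam a (2 * k) (-x) =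
      discretePotential lam a (2 * k) x) → a (2 * k + 1) = -a (2 * k) := by
    intro k heven
    -- Testing `-a (2k)` against the choice of `a (2k+1)`, and `a (2k+1)` against that of `a (2k)`,
    -- forces their distance to be maximal.
    have h1 := ha.le (2 * k + 1) (-a (2 * k))
    have h2 := ha.le (2 * k) (a (2 * k + 1))
    rw [discretePotential_succ, discretePotential_succ, heven, norm_neg_sub_rpow] at h1
    exact eq_neg_of_two_rpow_le h0 (by linarith)
  induction k with
  | zero =>
    have h : ∀ x, discretePotential lam a (2 * 0) (-x) = discretePotential lam a (2 * 0) x := by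
      simp [discretePotential]
    exact ⟨h, odd 0 h⟩
  | succ k ih =>
    have h : ∀ x, discretePotential lam a (2 * (k + 1)) (-x) =
        discretePotential lam a (2 * (k + 1)) x := by
      intro x
      rw [show 2 * (k + 1) = 2 * k + 1 + 1 by ring]
      simp only [discretePotential_succ, ih.1, ih.2, coe_neg_sphere]
      rw [show -(x : EuclideanSpace ℝ (Fin (d + 1))) - a (2 * k) = -(x - -a (2 * k)) by abel,
        show -(x : EuclideanSpace ℝ (Fin (d + 1))) - -a (2 * k) = -(x - a (2 * k)) by abel,
        norm_neg, norm_neg]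
      ring
    exact ⟨h, odd _ h⟩

lemma IsGreedyEnergySequence.odd_eq (h0 : 0 < lam) (ha : IsGreedyEnergySequence lam a) (k : ℕ) :
    discretePotential lam a (2 * k + 1) (a (2 * k + 1)) =
      discretePotential lam a (2 * k) (a (2 * k)) + 2 ^ lam := by
  obtain ⟨h1, h2⟩ := ha.antipodal h0 k
  rw [discretePotential_succ, h2, h1, norm_neg_sub_rpow]

lemma IsGreedyEnergySequence.le_succ (h0 : 0 < lam) (ha : IsGreedyEnergySequence lam a) (n : ℕ) :
    discretePotential lam a n (a n) ≤ discretePotential lam a (n + 1) (a (n + 1)) :=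
  (discretePotential_succ_self h0 n).symm.trans_le (ha.le _ _)

lemma integral_discretePotential (h0 : 0 < lam) (n : ℕ) :
    ∫ x, discretePotential lam a n x ∂uniformMeasure d =
      n * contEnergy lam (uniformMeasure d) := by
  have hi : ∀ k, Integrable (fun x : UnitSphere d =>
      ‖(x : EuclideanSpace ℝ (Fin (d + 1))) - a k‖ ^ lam) (uniformMeasure d) := fun k =>
    integrable_of_continuous_sphere
      (Continuous.rpow_const (by fun_prop) fun _ => Or.inr h0.le)
  simp only [discretePotential]
  rw [integral_finsetSum _ fun k _ => hi k,
    Finset.sum_congr rfl fun k _ => show _ = contEnergy lam (uniformMeasure d) by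
      rw [contEnergy_eq_integral h0 (a k)]
      simp_rw [norm_sub_rpow_eq]]
  simp

lemma IsGreedyEnergySequence.lt_potential (hd : 1 ≤ d) (h0 : 0 < lam) (h2 : lam < 2)
    (ha : IsGreedyEnergySequence lam a) {n : ℕ} (hn : 1 ≤ n) :
    n * contEnergy lam (uniformMeasure d) < discretePotential lam a n (a n) := by
  obtain ⟨y, hy⟩ : ∃ y, discretePotential lam a n y < discretePotential lam a n (a n) := by
    by_contra! h
    exact not_exists_forall_discretePotential_eq hd h0 h2 a hn
      ⟨_, fun x => le_antisymm (ha.le n x) (h x)⟩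
  have hc : Continuous fun x =>
      discretePotential lam a n (a n) - discretePotential lam a n x :=
    continuous_const.sub (continuous_discretePotential h0 n)
  have hpos := hc.integral_pos_of_hasCompactSupport_nonneg_nonzero (μ := uniformMeasure d)
    (HasCompactSupport.of_compactSpace _) (fun x => sub_nonneg.2 (ha.le n x))
    (x := y) (sub_pos.2 hy).ne'
  rw [integral_sub (integrable_const _)
    (integrable_of_continuous_sphere (continuous_discretePotential h0 n)),
    integral_discretePotential h0] at hpos
  simpa using hpos

lemma discretePotential_le (h0 : 0 < lam) (n : ℕ) (x : UnitSphere d) :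
    discretePotential lam a n x ≤ n * 2 ^ lam := by
  simpa [discretePotential] using Finset.sum_le_card_nsmul (Finset.range n) _ _
    fun k _ => norm_sub_rpow_le_two_rpow h0 x (a k)

/-- The diagonal vanishes, and each pair `i < j` appears once, in `U_j(a_j)`. -/
lemma sum_norm_sub_rpow_eq_two_mul_sum (h0 : 0 < lam) (N : ℕ) :
    ∑ i ∈ Finset.range N, ∑ j ∈ Finset.range N,
        ‖(a i : EuclideanSpace ℝ (Fin (d + 1))) - a j‖ ^ lam =
      2 * ∑ n ∈ Finset.range N, discretePotential lam a n (a n) := by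
  induction N with
  | zero => simp
  | succ N ih =>
    have hsymm : ∑ i ∈ Finset.range N, ‖(a i : EuclideanSpace ℝ (Fin (d + 1))) - a N‖ ^ lam =
        discretePotential lam a N (a N) :=
      Finset.sum_congr rfl fun i _ => by rw [norm_sub_rev]
    have hlast := discretePotential_succ_self (a := a) h0 N
    simp only [discretePotential] at hlast hsymm ⊢
    rw [Finset.sum_range_succ, hlast, Finset.sum_range_succ (fun n => ∑ k ∈ _, _)]
    simp_rw [Finset.sum_range_succ _ N, Finset.sum_add_distrib]
    rw [ih, hsymm]
    simp only [discretePotential]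
    ring

/-- A nondecreasing sequence with `u n ≥ n I` whose partial sums are at most `N² I / 2` satisfies
`u n / n → I`. -/
lemma tendsto_div_of_monotone_of_sum_le {u : ℕ → ℝ} {I : ℝ} (hmono : Monotone u)
    (hlow : ∀ n : ℕ, n * I ≤ u n)
    (hsum : ∀ N : ℕ, ∑ n ∈ Finset.range N, u n ≤ (N : ℝ) ^ 2 * I / 2) :
    Tendsto (fun n : ℕ => u n / n) atTop (𝓝 I) := by
  have hsq : Tendsto Nat.sqrt atTop atTop :=
    tendsto_atTop.2 fun b => by
      filter_upwards [eventually_ge_atTop (b * b)] with n hn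
      exact Nat.le_sqrt.2 hn
  have hI : 0 ≤ I := by
    have h1 := hsum 1
    have h2 := hlow 0
    simp only [Finset.sum_range_one, Nat.cast_one, Nat.cast_zero] at h1 h2
    linarith
  have hgauss : ∀ n : ℕ, (n : ℝ) * (n - 1) / 2 * I ≤ ∑ j ∈ Finset.range n, u j := by
    intro n
    induction n with
    | zero => simp
    | succ n ih =>
      rw [Finset.sum_range_succ]
      have := hlow n
      push_cast
      linarith
  -- By monotonicity `k u_n` is at most the sum over the block `[n, n + k)`, which is bounded by `(n
  -- + k)² I / 2 - n (n - 1) I / 2`.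
  have hup : ∀ n k : ℕ, (k : ℝ) * u n ≤ (n * k + k ^ 2 / 2 + n / 2) * I := by
    intro n k
    have h1 := Finset.sum_range_add u n k
    have h2 : (k : ℝ) * u n ≤ ∑ x ∈ Finset.range k, u (n + x) := by
      simpa using Finset.card_nsmul_le_sum (Finset.range k) _ _
        fun x _ => hmono (Nat.le_add_right n x)
    have h3 := hsum (n + k)
    have h4 := hgauss n
    push_cast at h3
    linarith
  have hlim : Tendsto (fun n : ℕ => (1 + 1 / (Nat.sqrt n : ℝ)) * I) atTop (𝓝 I) := by
    have h := (tendsto_one_div_atTop_nhds_zero_nat (𝕜 := ℝ)).comp hsq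
    simpa using (h.const_add 1).mul_const I
  refine tendsto_of_tendsto_of_tendsto_of_le_of_le' tendsto_const_nhds hlim ?_ ?_
  · filter_upwards [eventually_ge_atTop 1] with n hn
    rw [le_div_iff₀ (by exact_mod_cast hn), mul_comm]
    exact hlow n
  · filter_upwards [eventually_ge_atTop 1] with n hn
    -- Dividing `hup` by `n k` leaves the errors `k / (2n)` and `1 / (2k)`; the choice `k ≈ √n`
    -- balances them.
    set k := Nat.sqrt n with hk
    have hn0 : (0 : ℝ) < n := by exact_mod_cast hn
    have hk0 : (0 : ℝ) < k := by exact_mod_cast Nat.sqrt_pos.2 hn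
    have hkn : (k : ℝ) ^ 2 ≤ n := by exact_mod_cast Nat.sqrt_le' n
    rw [div_le_iff₀ hn0]
    apply le_of_mul_le_mul_left _ hk0
    refine (hup n k).trans ?_
    have heq : (k : ℝ) * ((1 + 1 / (k : ℝ)) * I * n) = (n * k + n) * I := by
      field_simp
    rw [heq]
    exact mul_le_mul_of_nonneg_right (by linarith) hI

end Greedy

theorem theorem3p3 (d : ℕ) (hd : 1 ≤ d) (lam : ℝ) (hlam0 : 0 < lam) (hlam2 : lam < 2)
    (a : ℕ → UnitSphere d) (ha : IsGreedyEnergySequence lam a) :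
    (∀ n : ℕ, 1 ≤ n →
      discretePotential lam a n (a n) ≤ discretePotential lam a (n + 1) (a (n + 1)) ∧
      discretePotential lam a (n + 1) (a (n + 1)) ≤ discretePotential lam a n (a n) +
        ‖(a (n + 1) : EuclideanSpace ℝ (Fin (d + 1))) - a n‖ ^ lam) ∧
    (∀ n : ℕ, 1 ≤ n → ¬ ∃ c : ℝ, ∀ x : UnitSphere d, discretePotential lam a n x = c) ∧
    (∀ n : ℕ, 1 ≤ n →
      (n : ℝ) * contEnergy lam (uniformMeasure d) < discretePotential lam a n (a n) ∧
      discretePotential lam a n (a n) ≤ (n : ℝ) * (2 : ℝ) ^ lam) ∧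
    (∀ k : ℕ,
      discretePotential lam a (2 * k + 1) (a (2 * k + 1)) =
        discretePotential lam a (2 * k) (a (2 * k)) + (2 : ℝ) ^ lam) ∧
    Tendsto (fun n : ℕ => discretePotential lam a n (a n) / (n : ℝ)) atTop
      (𝓝 (contEnergy lam (uniformMeasure d))) := by
  refine ⟨fun n _ => ⟨ha.le_succ hlam0 n, ?_⟩,
    fun n hn => not_exists_forall_discretePotential_eq hd hlam0 hlam2 a hn,
    fun n hn => ⟨ha.lt_potential hd hlam0 hlam2 hn, discretePotential_le hlam0 n _⟩,
    ha.odd_eq hlam0, ?_⟩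
  · rw [discretePotential_succ]
    linarith [ha.le n (a (n + 1))]
  · refine tendsto_div_of_monotone_of_sum_le (monotone_nat_of_le_succ (ha.le_succ hlam0))
      (fun n => ?_) fun N => ?_
    · rcases Nat.eq_zero_or_pos n with rfl | hn
      · simp [discretePotential]
      · exact (ha.lt_potential hd hlam0 hlam2 hn).le
    · have h := sum_norm_sub_rpow_le_contEnergy hlam0 hlam2.le N a
      rw [sum_norm_sub_rpow_eq_two_mul_sum hlam0] at h
      linarith
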